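/- Let $A$ be a unital separable $C^*$-algebra with stable rank one, i.e. such that the invertible elements of $A$ are dense in $A$. Let $M_\infty(A)=\varinjlim M_n(A)$ be the algebraic direct limit along the corner embeddings $a\mapsto \begin{pmatrix} a&0\\0&0\end{pmatrix}$, with its $C^*$-norm, and let $M_\infty(A)_+$ be the set of its positive elements. For $a,b\in M_\infty(A)_+$ write $a\precsim b$ if there is a sequence $(v_k)$ in $M_\infty(A)$ with $\|v_kbv_k^*-a\|\to 0$, and $a\sim b$ if $a\precsim b$ and $b\precsim a$. Let $\langle a\rangle$ denote the $\sim$-class of $a$, and let $W(A)=M_\infty(A)_+/{\sim}$ be the Cuntz semigroup, partially ordered by $\langle a\rangle\le\langle b\rangle\iff a\precsim b$. Let $(\langle a_n\rangle)_{n\in\mathbb N}$ be a bounded increasing sequence in $W(A)$ with supremum (least upper bound in $W(A)$) $\langle a\rangle$, and let $p\in M_\infty(A)$ be a projection. Then $\langle a\rangle=\langle p\rangle$ if and only if there exists $n_0$ such that $\langle a_n\rangle=\langle p\rangle$ for all $n\ge n_0$. -/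

import Mathlib

open Filter Topology

noncomputable section

namespace CuntzW

section Basic

/-- The upper left corner embedding of `n × n` matrices into `N × N` matrices, for `n ≤ N`, that
fills up with zeros. -/
def padFun {A : Type*} [Zero A] (n N : ℕ) (a : CStarMatrix (Fin n) (Fin n) A) :
    CStarMatrix (Fin N) (Fin N) A :=
  fun i j => if hij : i.val < n ∧ j.val < n then a ⟨i, hij.1⟩ ⟨j, hij.2⟩ else 0

theorem padFun_apply {A : Type*} [Zero A] (n N : ℕ) (a : CStarMatrix (Fin n) (Fin n) A)
    (i j : Fin N) :
    padFun n N a i j =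
      if hij : i.val < n ∧ j.val < n then a ⟨i, hij.1⟩ ⟨j, hij.2⟩ else 0 := rfl

variable (A : Type*) [CStarAlgebra A]

/-- The connecting map `M_n(A) → M_N(A)`, for `n ≤ N`, as a `*`-homomorphism. -/
def pad (n N : ℕ) (h : n ≤ N) :
    CStarMatrix (Fin n) (Fin n) A →⋆ₙₐ[ℂ] CStarMatrix (Fin N) (Fin N) A where
  toFun := padFun n N
  map_smul' c a := by
    ext i j
    by_cases hij : i.val < n ∧ j.val < n <;> simp [padFun_apply, hij]
  map_zero' := by
    ext i j
    by_cases hij : i.val < n ∧ j.val < n <;> simp [padFun_apply]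
  map_add' a b := by
    ext i j
    by_cases hij : i.val < n ∧ j.val < n <;> simp [padFun_apply, hij]
  map_mul' a b := by
    ext i j
    simp only [CStarMatrix.mul_apply, padFun_apply]
    by_cases hij : i.val < n ∧ j.val < n
    · rw [dif_pos hij]
      refine Finset.sum_of_injOn (Fin.castLE h) (Fin.castLE_injective h).injOn
        (by simp) ?_ ?_
      · intro k _ hk
        have hk' : ¬ k.val < n := fun hlt => hk ⟨⟨k, hlt⟩, by simp, by ext; simp⟩
        simp [hk']
      · intro k _
        simp [hij.1, hij.2]
    · rw [dif_neg hij]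
      symm
      refine Finset.sum_eq_zero fun k _ => ?_
      by_cases hi : i.val < n
      · have hj : ¬ j.val < n := fun hj => hij ⟨hi, hj⟩
        simp [hj]
      · simp [hi]
  map_star' a := by
    ext i j
    by_cases hij : i.val < n ∧ j.val < n
    · simp [CStarMatrix.star_apply, padFun_apply, hij.1, hij.2]
    · have hji : ¬ (j.val < n ∧ i.val < n) := fun hh => hij ⟨hh.2, hh.1⟩
      rw [CStarMatrix.star_apply, padFun_apply, padFun_apply, dif_neg hij, dif_neg hji, star_zero]

variable {A} in
theorem pad_apply (n N : ℕ) (h : n ≤ N) (a : CStarMatrix (Fin n) (Fin n) A) (i j : Fin N) :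
    pad A n N h a i j =
      if hij : i.val < n ∧ j.val < n then a ⟨i, hij.1⟩ ⟨j, hij.2⟩ else 0 := rfl

theorem pad_injective (n N : ℕ) (h : n ≤ N) : Function.Injective (pad A n N h) := by
  intro a b hab
  ext i j
  have := congrArg (fun M : CStarMatrix (Fin N) (Fin N) A => M (Fin.castLE h i) (Fin.castLE h j))
    hab
  simpa [pad_apply] using this

instance pad_directedSystem :
    DirectedSystem (fun n : ℕ => CStarMatrix (Fin n) (Fin n) A) (pad A · · ·) where
  map_self n a := by
    ext i j
    simp [pad_apply]
  map_map k j i hij hjk a := by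
    ext p q
    simp only [pad_apply]
    by_cases hpq : p.val < i ∧ q.val < i
    · have h1 : p.val < j ∧ q.val < j := ⟨hpq.1.trans_le hij, hpq.2.trans_le hij⟩
      simp [hpq.1, hpq.2, h1.1, h1.2]
    · simp [hpq]

/-- `M_∞(A)`: the algebraic direct limit of the matrix algebras `M_n(A)` along `pad`. -/
def MInfty : Type _ :=
  DirectLimit (fun n : ℕ => CStarMatrix (Fin n) (Fin n) A) (pad A)

namespace MInfty

instance instNonUnitalRing : NonUnitalRing (MInfty A) :=
  inferInstanceAs (NonUnitalRing
    (DirectLimit (fun n : ℕ => CStarMatrix (Fin n) (Fin n) A) (pad A)))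

instance instStarRing : StarRing (MInfty A) :=
  inferInstanceAs (StarRing
    (DirectLimit (fun n : ℕ => CStarMatrix (Fin n) (Fin n) A) (pad A)))

variable {A}

/-- The canonical map `M_n(A) → M_∞(A)`. -/
def of (n : ℕ) (a : CStarMatrix (Fin n) (Fin n) A) : MInfty A :=
  (⟦⟨n, a⟩⟧ : DirectLimit (fun n : ℕ => CStarMatrix (Fin n) (Fin n) A) (pad A))

theorem exists_of (x : MInfty A) : ∃ n a, x = of n a :=
  DirectLimit.exists_eq_mk (pad A) x

theorem exists_of₂ (x y : MInfty A) : ∃ n a b, x = of n a ∧ y = of n b :=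
  DirectLimit.exists_eq_mk₂ (pad A) x y

theorem of_pad (n N : ℕ) (h : n ≤ N) (a : CStarMatrix (Fin n) (Fin n) A) :
    of N (pad A n N h a) = of n a :=
  DirectLimit.mk_apply (F := fun n : ℕ => CStarMatrix (Fin n) (Fin n) A) (f := pad A) n N a h

theorem of_injective (n : ℕ) :
    Function.Injective (of n : CStarMatrix (Fin n) (Fin n) A → MInfty A) :=
  DirectLimit.mk_injective (pad A) (pad_injective A) n

theorem of_zero (n : ℕ) : of n (0 : CStarMatrix (Fin n) (Fin n) A) = 0 :=
  (DirectLimit.zero_def (f := pad A) n).symm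

theorem of_add (n : ℕ) (a b : CStarMatrix (Fin n) (Fin n) A) :
    of n (a + b) = of n a + of n b :=
  (DirectLimit.add_def (G := fun n : ℕ => CStarMatrix (Fin n) (Fin n) A) (f := pad A) n a b).symm

theorem of_neg (n : ℕ) (a : CStarMatrix (Fin n) (Fin n) A) : of n (-a) = -of n a :=
  (DirectLimit.neg_def (G := fun n : ℕ => CStarMatrix (Fin n) (Fin n) A) (f := pad A) n a).symm

theorem of_mul (n : ℕ) (a b : CStarMatrix (Fin n) (Fin n) A) :
    of n (a * b) = of n a * of n b :=
  (DirectLimit.mul_def (G := fun n : ℕ => CStarMatrix (Fin n) (Fin n) A) (f := pad A) n a b).symm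

theorem of_star (n : ℕ) (a : CStarMatrix (Fin n) (Fin n) A) : of n (star a) = star (of n a) :=
  (DirectLimit.star_def (G := fun n : ℕ => CStarMatrix (Fin n) (Fin n) A) (f := pad A) n a).symm

end MInfty

section Positive

variable {A}

/-- Positive elements of `M_∞(A)`: those of the form `x* x`. -/
def IsPositive (a : MInfty A) : Prop := ∃ x : MInfty A, a = star x * x

/-- Projections are positive. -/
theorem isPositive_of_isStarProjection {p : MInfty A} (hp : IsStarProjection p) :
    IsPositive p :=
  ⟨p, by rw [hp.isSelfAdjoint.star_eq, hp.isIdempotentElem.eq]⟩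

variable (A) in
/-- `M_∞(A)_+`. -/
abbrev PosMInfty : Type _ := {a : MInfty A // IsPositive a}

end Positive

end Basic

namespace MInfty

variable {A : Type*} [CStarAlgebra A] [PartialOrder A] [StarOrderedRing A]

/-- The norm of `M_∞(A)`: it restricts to the C⋆-norm on every `M_n(A)`. -/
instance instNorm : Norm (MInfty A) where
  norm := DirectLimit.lift (pad A) (fun _ a => ‖a‖) fun n N h a =>
    (NonUnitalStarAlgHom.norm_map (pad A n N h) (pad_injective A n N h) a).symm

theorem norm_of (n : ℕ) (a : CStarMatrix (Fin n) (Fin n) A) : ‖of n a‖ = ‖a‖ := rfl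

variable (A) in
/-- The norm as a bundled group norm. -/
def groupNorm : AddGroupNorm (MInfty A) where
  toFun x := ‖x‖
  map_zero' := by
    rw [← of_zero 0, norm_of, norm_zero]
  add_le' x y := by
    obtain ⟨n, a, b, rfl, rfl⟩ := exists_of₂ x y
    rw [← of_add]
    exact norm_add_le a b
  neg' x := by
    obtain ⟨n, a, rfl⟩ := exists_of x
    rw [← of_neg]
    exact norm_neg a
  eq_zero_of_map_eq_zero' x hx := by
    obtain ⟨n, a, rfl⟩ := exists_of x
    have ha : a = 0 := norm_eq_zero.mp hx
    rw [ha, of_zero]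

instance instNonUnitalNormedRing : NonUnitalNormedRing (MInfty A) where
  toNorm := instNorm
  toNonUnitalRing := instNonUnitalRing A
  toMetricSpace := (groupNorm A).toNormedAddCommGroup.toMetricSpace
  dist_eq := (groupNorm A).toNormedAddCommGroup.dist_eq
  norm_mul_le x y := by
    obtain ⟨n, a, b, rfl, rfl⟩ := exists_of₂ x y
    rw [← of_mul]
    exact norm_mul_le a b

instance instNormedStarGroup : NormedStarGroup (MInfty A) where
  norm_star_le x := by
    obtain ⟨n, a, rfl⟩ := exists_of x
    rw [← of_star]
    exact (norm_star a).le

end MInfty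

section Cuntz

variable {A : Type*} [CStarAlgebra A] [PartialOrder A] [StarOrderedRing A]

/-- Cuntz subequivalence `a ≾ b`: there is a sequence `(v_k)` in `M_∞(A)` with
`‖v_k b v_k* - a‖ → 0`. -/
def CuntzLE (a b : PosMInfty A) : Prop :=
  ∃ v : ℕ → MInfty A, Tendsto (fun k => ‖v k * b.1 * star (v k) - a.1‖) atTop (𝓝 0)

theorem cuntzLE_iff (a b : PosMInfty A) :
    CuntzLE a b ↔ ∀ ε > 0, ∃ v : MInfty A, ‖v * b.1 * star v - a.1‖ < ε := by
  constructor
  · rintro ⟨v, hv⟩ ε hε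
    obtain ⟨k, hk⟩ := (hv.eventually_lt_const hε).exists
    exact ⟨v k, hk⟩
  · intro h
    choose v hv using fun k : ℕ => h (1 / ((k : ℝ) + 1)) Nat.one_div_pos_of_nat
    exact ⟨v, squeeze_zero (fun _ => norm_nonneg _) (fun k => (hv k).le)
      tendsto_one_div_add_atTop_nhds_zero_nat⟩

theorem CuntzLE.refl (a : PosMInfty A) : CuntzLE a a := by
  rw [cuntzLE_iff]
  intro ε hε
  obtain ⟨n, x, hx⟩ := MInfty.exists_of a.1
  refine ⟨MInfty.of n 1, ?_⟩
  rw [hx, ← MInfty.of_star, ← MInfty.of_mul, ← MInfty.of_mul, star_one, mul_one, one_mul,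
    sub_self, norm_zero]
  exact hε

theorem CuntzLE.trans {a b c : PosMInfty A} (hab : CuntzLE a b) (hbc : CuntzLE b c) :
    CuntzLE a c := by
  rw [cuntzLE_iff] at *
  intro ε hε
  obtain ⟨v, hv⟩ := hab (ε / 2) (by positivity)
  obtain ⟨w, hw⟩ := hbc (ε / 2 / (‖v‖ * ‖v‖ + 1)) (by positivity)
  refine ⟨v * w, ?_⟩
  have e : v * w * c.1 * star (v * w) - a.1 =
      v * (w * c.1 * star w - b.1) * star v + (v * b.1 * star v - a.1) := by
    rw [star_mul]
    noncomm_ring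
  have h1 : ‖v * (w * c.1 * star w - b.1) * star v‖ ≤ ε / 2 := by
    calc ‖v * (w * c.1 * star w - b.1) * star v‖
        ≤ ‖v * (w * c.1 * star w - b.1)‖ * ‖star v‖ := norm_mul_le _ _
      _ ≤ ‖v‖ * ‖w * c.1 * star w - b.1‖ * ‖v‖ := by
          rw [norm_star]
          gcongr
          exact norm_mul_le _ _
      _ = ‖w * c.1 * star w - b.1‖ * (‖v‖ * ‖v‖) := by ring
      _ ≤ ε / 2 / (‖v‖ * ‖v‖ + 1) * (‖v‖ * ‖v‖ + 1) := by
          gcongr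
          linarith
      _ = ε / 2 := div_mul_cancel₀ _ (by positivity)
  calc ‖v * w * c.1 * star (v * w) - a.1‖
      ≤ ‖v * (w * c.1 * star w - b.1) * star v‖ + ‖v * b.1 * star v - a.1‖ := by
        rw [e]
        exact norm_add_le _ _
    _ < ε := by linarith

/-- Cuntz equivalence `a ∼ b`: both `a ≾ b` and `b ≾ a`. -/
def CuntzEquiv (a b : PosMInfty A) : Prop := CuntzLE a b ∧ CuntzLE b a

variable (A) in
/-- Cuntz equivalence as a setoid. -/
abbrev cuntzSetoid : Setoid (PosMInfty A) where
  r := CuntzEquiv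
  iseqv := ⟨fun a => ⟨.refl a, .refl a⟩, fun h => ⟨h.2, h.1⟩,
    fun h₁ h₂ => ⟨h₁.1.trans h₂.1, h₂.2.trans h₁.2⟩⟩

variable (A) in
/-- The Cuntz semigroup `W(A) = M_∞(A)_+ / ∼`, as an ordered set. -/
def CuntzSemigroup : Type _ := Quotient (cuntzSetoid A)

/-- The class `⟨a⟩` in `W(A)` of a positive element `a` of `M_∞(A)`. -/
def cuntzClass (a : PosMInfty A) : CuntzSemigroup A := Quotient.mk (cuntzSetoid A) a

theorem cuntzClass_eq_iff (a b : PosMInfty A) :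
    cuntzClass a = cuntzClass b ↔ CuntzEquiv a b :=
  Quotient.eq (r := cuntzSetoid A)

/-- The order of `W(A)`: `⟨a⟩ ≤ ⟨b⟩` if and only if `a ≾ b`. -/
instance : PartialOrder (CuntzSemigroup A) where
  le := Quotient.lift₂ CuntzLE fun _ _ _ _ h₁ h₂ => propext
    ⟨fun h => h₁.2.trans (h.trans h₂.1), fun h => h₁.1.trans (h.trans h₂.2)⟩
  le_refl x := Quotient.inductionOn x CuntzLE.refl
  le_trans x y z := Quotient.inductionOn₃ x y z fun _ _ _ => CuntzLE.trans
  le_antisymm x y := Quotient.inductionOn₂ x y fun _ _ h₁ h₂ => Quotient.sound ⟨h₁, h₂⟩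

theorem cuntzClass_le_iff (a b : PosMInfty A) :
    cuntzClass a ≤ cuntzClass b ↔ CuntzLE a b := Iff.rfl

/-- The class `⟨p⟩` in `W(A)` of a projection `p` of `M_∞(A)`. -/
def projClass (p : MInfty A) (hp : IsStarProjection p) : CuntzSemigroup A :=
  cuntzClass ⟨p, isPositive_of_isStarProjection hp⟩

end Cuntz

/-- `A` has stable rank one: the invertible elements are dense in `A`. -/
def HasStableRankOne (A : Type*) [CStarAlgebra A] : Prop := Dense {a : A | IsUnit a}

end CuntzW

end

namespace CuntzW

/-! ### Functional calculus in a unital C⋆-algebra. -/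

section CStar

/-! The substance is that `⟨p⟩` cannot be the supremum of an increasing sequence unless it is
attained; the converse is order theory. Choose `N` with `p` in `M_N(A)`. It suffices to build an
upper bound `b` of all `a n` as a norm limit of matrices `c n ∈ M_N(A)`, each nearly of the form `w
(a n) w*`. If `p ≾ b`, then `p` is within distance one of a conjugate of some `a n`, and a positive
element that close to a projection dominates it exactly (`exists_conj_eq_of_norm_sub_lt_one`), so `p
≾ a n`.

Stable rank one makes the `c n` converge. Subequivalence `a ≾ p` gives `W` with `W W*` near `a` and
`W* W` in `M_N(A)`, but such copies of successive terms in `M_N(A)` need not be close to each other.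
Density of invertibles, inherited by `M_N(A)`, gives unitaries carrying `y* y` approximately to `y
y*`; conjugating by one moves the copy of the next term close to the current `c`
(`exists_positive_near`). Each `c n` also carries a radius within which every matrix still almost
dominates a prescribed earlier term. Keeping the limit inside all these balls makes it an upper
bound (`exists_upper_bound_of_cuntzLE`). -/

theorem norm_le_one_of_star_mul_self {B : Type*} [CStarAlgebra B] {u : B} (hu : star u * u = 1) : ‖u‖ ≤ 1 := by
  rw [← sq_le_one_iff₀ (norm_nonneg _), sq, ← CStarRing.norm_star_mul_self, hu]
  rcases subsingleton_or_nontrivial B with h | h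
  · rw [Subsingleton.elim (1 : B) 0, norm_zero]; exact zero_le_one
  · exact CStarRing.norm_one.le

theorem norm_conj_le {R : Type*} [NonUnitalNormedRing R] [StarRing R] [NormedStarGroup R]
    (v z : R) : ‖v * z * star v‖ ≤ ‖v‖ ^ 2 * ‖z‖ := by
  calc ‖v * z * star v‖ ≤ ‖v‖ * ‖z‖ * ‖star v‖ :=
        (norm_mul_le _ _).trans (by gcongr; exact norm_mul_le _ _)
    _ = ‖v‖ ^ 2 * ‖z‖ := by rw [norm_star]; ring

variable {B : Type*} [CStarAlgebra B] [PartialOrder B] [StarOrderedRing B]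

/-- For `P ≥ 0` and `ζ > 0`, the elements `G = (P + ζ)^{1/2}` and `H = (P + ζ)^{-1/2}`. -/
theorem exists_sqrt_add_smul_one {P : B} (hP : 0 ≤ P) {ζ : ℝ} (hζ : 0 < ζ) :
    ∃ G H : B, IsSelfAdjoint G ∧ IsSelfAdjoint H ∧ H * G = 1 ∧ G * G = P + ζ • 1 ∧
      H * P * H + ζ • (H * H) = 1 ∧ ‖H * P * H‖ ≤ 1 ∧ ‖H * H‖ ≤ ζ⁻¹ := by
  have hsa : IsSelfAdjoint P := IsSelfAdjoint.of_nonneg hP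
  -- The absolute value makes all the functions continuous on the whole line; on the spectrum of `P`
  -- it changes nothing.
  have hpos : ∀ t : ℝ, 0 < |t| + ζ := fun t => by positivity
  have hne : ∀ t : ℝ, √(|t| + ζ) ≠ 0 := fun t => (Real.sqrt_pos.2 (hpos t)).ne'
  have hsq : ∀ t : ℝ, √(|t| + ζ) * √(|t| + ζ) = |t| + ζ :=
    fun t => Real.mul_self_sqrt (hpos t).le
  have hg : Continuous fun t : ℝ => √(|t| + ζ) := by fun_prop
  have hh : Continuous fun t : ℝ => (√(|t| + ζ))⁻¹ := hg.inv₀ hne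
  have hspec : ∀ t ∈ spectrum ℝ P, |t| = t :=
    fun t ht => abs_of_nonneg (spectrum_nonneg_of_nonneg hP ht)
  have hid : cfc (fun t : ℝ => t) P = P := cfc_id' ℝ P
  have hmul : ∀ f g : ℝ → ℝ, Continuous f → Continuous g →
      cfc f P * cfc g P = cfc (fun t => f t * g t) P := fun f g hf hg =>
    (cfc_mul f g P hf.continuousOn hg.continuousOn).symm
  have hHPH : cfc (fun t : ℝ => (√(|t| + ζ))⁻¹) P * P * cfc (fun t : ℝ => (√(|t| + ζ))⁻¹) P
      = cfc (fun t : ℝ => t / (|t| + ζ)) P := by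
    nth_rewrite 2 [← hid]
    rw [hmul _ _ hh continuous_id', hmul _ _ (by fun_prop) hh]
    refine cfc_congr fun t _ => ?_
    calc (√(|t| + ζ))⁻¹ * t * (√(|t| + ζ))⁻¹ = t * (√(|t| + ζ) * √(|t| + ζ))⁻¹ := by
          rw [mul_inv]; ring
      _ = t / (|t| + ζ) := by rw [hsq, div_eq_mul_inv]
  have hHH : cfc (fun t : ℝ => (√(|t| + ζ))⁻¹) P * cfc (fun t : ℝ => (√(|t| + ζ))⁻¹) P
      = cfc (fun t : ℝ => (|t| + ζ)⁻¹) P := by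
    rw [hmul _ _ hh hh]
    exact cfc_congr fun t _ => by simp only [← mul_inv, hsq]
  refine ⟨cfc (fun t : ℝ => √(|t| + ζ)) P, cfc (fun t : ℝ => (√(|t| + ζ))⁻¹) P,
    IsSelfAdjoint.cfc, IsSelfAdjoint.cfc, ?_, ?_, ?_, ?_, ?_⟩
  · rw [hmul _ _ hh hg, ← cfc_one ℝ P]
    exact cfc_congr fun t _ => inv_mul_cancel₀ (hne t)
  · rw [hmul _ _ hg hg]
    have : P + ζ • (1 : B) = cfc (fun t : ℝ => t + ζ) P := by
      rw [cfc_add_const ζ (fun t : ℝ => t) P, hid, Algebra.algebraMap_eq_smul_one]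
    rw [this]
    exact cfc_congr fun t ht => (hsq t).trans (by rw [hspec t ht])
  · have h1 : Continuous fun t : ℝ => t / (|t| + ζ) :=
      continuous_id.div (by fun_prop) fun t => (hpos t).ne'
    have h2 : Continuous fun t : ℝ => (|t| + ζ)⁻¹ :=
      Continuous.inv₀ (by fun_prop) fun t => (hpos t).ne'
    have h3 : Continuous fun t : ℝ => ζ • (|t| + ζ)⁻¹ := h2.const_smul ζ
    rw [hHPH, hHH, ← cfc_smul ζ _ P h2.continuousOn,
      ← cfc_add P _ _ h1.continuousOn h3.continuousOn, ← cfc_one ℝ P]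
    refine cfc_congr fun t ht => ?_
    have := (hpos t).ne'
    rw [hspec t ht] at this
    simp only [smul_eq_mul, hspec t ht, Pi.one_apply]
    field_simp
  · rw [hHPH]
    refine norm_cfc_le zero_le_one fun t _ => ?_
    rw [Real.norm_eq_abs, abs_div, abs_of_pos (hpos t), div_le_one (hpos t)]
    linarith
  · rw [hHH]
    refine norm_cfc_le (by positivity) fun t _ => ?_
    rw [Real.norm_eq_abs, abs_of_pos (inv_pos.2 (hpos t))]
    exact inv_anti₀ hζ (by linarith [abs_nonneg t])

/-- `x* x` is, up to `ζ`, a contractive conjugate of `x x*`. -/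
theorem exists_contraction_conj (x : B) {ζ : ℝ} (hζ : 0 < ζ) :
    ∃ v : B, ‖v‖ ≤ 1 ∧ ‖v * (x * star x) * star v - star x * x‖ ≤ ζ := by
  obtain ⟨G, H, -, hH, -, -, h1, hn, -⟩ :=
    exists_sqrt_add_smul_one (mul_star_self_nonneg x) hζ
  have hv : ‖star x * H‖ ≤ 1 := by
    rw [← sq_le_one_iff₀ (norm_nonneg _), sq, ← CStarRing.norm_star_mul_self]
    simpa [star_mul, hH.star_eq, mul_assoc] using hn
  refine ⟨star x * H, hv, ?_⟩
  -- With `v = x* H`, the error is exactly `-ζ v v*`.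
  have key : star x * H * (x * star x) * star (star x * H) - star x * x
      = -(ζ • (star x * H * star (star x * H))) := by
    have h2 : H * (x * star x) * H - 1 = -(ζ • (H * H)) := by rw [← h1]; abel
    calc star x * H * (x * star x) * star (star x * H) - star x * x
        = star x * (H * (x * star x) * H - 1) * x := by
          simp only [star_mul, star_star, hH.star_eq]; noncomm_ring
      _ = _ := by rw [h2]; simp [hH.star_eq, mul_assoc]
  rw [key, norm_neg, norm_smul, Real.norm_of_nonneg hζ.le, CStarRing.norm_self_mul_star]
  nlinarith [norm_nonneg (star x * H), mul_le_one₀ hv (norm_nonneg _) hv]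

/-- An element `T` with `T* T = v* v + λ`, together with its inverse. -/
theorem exists_sqrt_star_mul_self_add (v : B) {l : ℝ} (hl : 0 < l) :
    ∃ T S : B, S * T = 1 ∧ star T * T = star v * v + l • 1 ∧ ‖T‖ ^ 2 ≤ ‖v‖ ^ 2 + l ∧
      ‖S‖ ^ 2 ≤ l⁻¹ := by
  obtain ⟨G, H, hG, hH, hHG, hGG, -, -, hn⟩ :=
    exists_sqrt_add_smul_one (star_mul_self_nonneg v) hl
  refine ⟨G, H, hHG, by rw [hG.star_eq, hGG], ?_, ?_⟩
  · rw [sq, ← CStarRing.norm_star_mul_self, hG.star_eq, hGG, sq, ← CStarRing.norm_star_mul_self]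
    refine (norm_add_le _ _).trans ?_
    gcongr
    rw [norm_smul, Real.norm_of_nonneg hl.le]
    have h1 : ‖(1 : B)‖ ≤ 1 := by
      rcases subsingleton_or_nontrivial B with h | h
      · rw [Subsingleton.elim (1 : B) 0, norm_zero]; exact zero_le_one
      · exact CStarRing.norm_one.le
    nlinarith
  · rw [sq, ← CStarRing.norm_star_mul_self, hH.star_eq]
    exact hn

/-- Replaces `v` by a left-invertible `T` at small cost: `T w` has almost the same `star (·) * (·)`
as `v w`, yet `w` is recovered from it by `S`, with a bound on `S` depending only on `l`. -/
theorem exists_sqrt_star_mul_self_add_mul (v w : B) {l : ℝ} (hl : 0 < l) :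
    ∃ T S : B, S * (T * w) = w ∧
      ‖star (T * w) * (T * w) - star (v * w) * (v * w)‖ ≤ l * ‖w‖ ^ 2 ∧
      ‖T‖ ^ 2 ≤ ‖v‖ ^ 2 + l ∧ ‖S‖ ^ 2 ≤ l⁻¹ := by
  obtain ⟨T, S, hST, hTT, hT, hS⟩ := exists_sqrt_star_mul_self_add v hl
  refine ⟨T, S, by rw [← mul_assoc, hST, one_mul], ?_, hT, hS⟩
  have e : star (T * w) * (T * w) - star (v * w) * (v * w) = l • (star w * w) := by
    calc _ = star w * (star T * T) * w - star w * (star v * v) * w := by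
          simp only [star_mul, mul_assoc]
      _ = _ := by rw [hTT]; simp [mul_add, add_mul]
  rw [e, norm_smul, Real.norm_of_nonneg hl.le, CStarRing.norm_star_mul_self, sq]

theorem nonneg_iff_exists_star_mul_self {a : B} : 0 ≤ a ↔ ∃ x, a = star x * x := by
  refine ⟨fun h => ⟨CFC.sqrt a, ?_⟩, ?_⟩
  · rw [(CFC.sqrt_nonneg a).isSelfAdjoint.star_eq, CFC.sqrt_mul_sqrt_self a h]
  · rintro ⟨x, rfl⟩
    exact star_mul_self_nonneg x

/-- An injective `*`-homomorphism reflects positivity. -/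
theorem nonneg_of_map_nonneg {C : Type*} [CStarAlgebra C] [PartialOrder C] [StarOrderedRing C]
    (φ : B →⋆ₙₐ[ℂ] C) (hφ : Function.Injective φ) {a : B} (ha : 0 ≤ φ a) : 0 ≤ a := by
  have hsa : IsSelfAdjoint a := hφ (by rw [map_star, ha.isSelfAdjoint.star_eq])
  have hn : (0 : B) ≤ a⁻ := CFC.negPart_nonneg a
  have hns : star (a⁻) = a⁻ := hn.isSelfAdjoint.star_eq
  -- The left side has positive image since `φ a ≥ 0`, the right side negative image, so the cube of
  -- `a⁻` vanishes.
  have hmul : a⁻ * a * a⁻ = -(a⁻ * a⁻ * a⁻) := by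
    have h1 : a⁻ * a = -(a⁻ * a⁻) := by
      nth_rewrite 2 [← CFC.posPart_sub_negPart a hsa]
      rw [mul_sub, CFC.negPart_mul_posPart, zero_sub]
    rw [h1, neg_mul]
  have hφn : star (φ a⁻) = φ a⁻ := by rw [← map_star, hns]
  have h1 : 0 ≤ φ (a⁻ * a * a⁻) := by
    have := star_left_conjugate_nonneg ha (φ a⁻)
    rwa [hφn, ← map_mul, ← map_mul] at this
  have h2 : 0 ≤ φ (a⁻ * a⁻ * a⁻) := by
    have h3 : 0 ≤ φ (a⁻) := by
      obtain ⟨x, hx⟩ := nonneg_iff_exists_star_mul_self.1 hn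
      rw [hx, map_mul, map_star]
      exact star_mul_self_nonneg _
    have := star_left_conjugate_nonneg h3 (φ a⁻)
    rwa [hφn, ← map_mul, ← map_mul] at this
  rw [hmul, map_neg, neg_nonneg] at h1
  have h0 : a⁻ * a⁻ * a⁻ = 0 := hφ ((le_antisymm h1 h2).trans (map_zero φ).symm)
  have h4 : a⁻ = 0 := by
    have h5 : a⁻ * a⁻ = 0 := by
      rw [← CStarRing.star_mul_self_eq_zero_iff, star_mul, hns, ← mul_assoc, h0, zero_mul]
    rwa [← CStarRing.star_mul_self_eq_zero_iff, hns]
  rw [← CFC.posPart_sub_negPart a hsa, h4, sub_zero]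
  exact CFC.posPart_nonneg a

/-- The unitary in the polar decomposition of an invertible `z` conjugates `z* z` to `z z*`. -/
theorem exists_unitary_conj_of_isUnit {z : B} (hz : IsUnit z) :
    ∃ u : B, star u * u = 1 ∧ u * star u = 1 ∧ u * (star z * z) * star u = z * star z := by
  have hQ : IsStrictlyPositive (star z * z) :=
    (hz.star.mul hz).isStrictlyPositive (star_mul_self_nonneg z)
  have h := CFC.conjugate_rpow_neg_one_half (star z * z) hQ
  set H := (star z * z) ^ (-(1 / 2) : ℝ) with hHdef
  have hH : IsSelfAdjoint H := IsSelfAdjoint.of_nonneg CFC.rpow_nonneg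
  have hHu : IsUnit H := by
    rw [isUnit_iff_exists_and_exists]
    exact ⟨⟨_, by rw [← mul_assoc]; exact h⟩, ⟨_, h⟩⟩
  have hu : star (z * H) * (z * H) = 1 := by
    rw [star_mul, hH.star_eq, ← h]; noncomm_ring
  refine ⟨z * H, hu, ?_, ?_⟩
  · obtain ⟨w, hw⟩ := (hz.mul hHu)
    rw [← hw] at hu ⊢
    have : star (w : B) = ↑w⁻¹ := by
      rw [← mul_one (star (w : B)), ← Units.mul_inv w, ← mul_assoc, hu, one_mul]
    rw [this, Units.mul_inv]
  · rw [star_mul, hH.star_eq]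
    calc z * H * (star z * z) * (H * star z) = z * (H * (star z * z) * H) * star z := by
          noncomm_ring
      _ = _ := by rw [h, mul_one]

/-- If the invertible elements are dense, then `y* y` and `y y*` are approximately unitarily
equivalent. -/
theorem exists_unitary_conj_near (hB : Dense {b : B | IsUnit b}) (y : B) {ε : ℝ} (hε : 0 < ε) :
    ∃ u : B, star u * u = 1 ∧ u * star u = 1 ∧
      ‖u * (star y * y) * star u - y * star y‖ < ε := by
  have ho : IsOpen {z : B | ‖star y * y - star z * z‖ < ε / 2 ∧
      ‖z * star z - y * star y‖ < ε / 2} :=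
    IsOpen.inter (isOpen_lt (f := fun z : B => ‖star y * y - star z * z‖) (by fun_prop)
      continuous_const) (isOpen_lt (f := fun z : B => ‖z * star z - y * star y‖) (by fun_prop)
      continuous_const)
  -- `y` itself may have no unitary polar part, so that of a nearby invertible `z` is used.
  obtain ⟨z, ⟨h1, h2⟩, hz⟩ := hB.inter_open_nonempty _ ho ⟨y, by simp [hε]⟩
  have hz : IsUnit z := hz
  obtain ⟨u, hu, hu', huz⟩ := exists_unitary_conj_of_isUnit hz
  refine ⟨u, hu, hu', ?_⟩
  have hn := norm_le_one_of_star_mul_self hu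
  have e : u * (star y * y) * star u - y * star y
      = u * (star y * y - star z * z) * star u + (z * star z - y * star y) := by
    rw [← huz]; noncomm_ring
  have h3 : ‖u * (star y * y - star z * z) * star u‖ ≤ ‖star y * y - star z * z‖ :=
    (norm_conj_le _ _).trans
      (mul_le_of_le_one_left (norm_nonneg _) (pow_le_one₀ (norm_nonneg _) hn))
  rw [e]
  linarith [norm_add_le (u * (star y * y - star z * z) * star u) (z * star z - y * star y)]

/-- A positive element at distance less than one from a projection dominates it. -/
theorem exists_conj_eq_of_norm_sub_lt_one {p w : B} (hp : IsStarProjection p) (hw : 0 ≤ w)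
    (h : ‖w - p‖ < 1) : ∃ x : B, x * w * star x = p := by
  have hpp : p * p = p := hp.isIdempotentElem.eq
  have hps : star p = p := hp.isSelfAdjoint.star_eq
  set t := p * w * p + (1 - p) with ht
  have htn : 0 ≤ t := by
    refine add_nonneg ?_ hp.one_sub.nonneg
    have := star_left_conjugate_nonneg hw p
    rwa [hps] at this
  have hpn : ‖p‖ ≤ 1 := hp.norm_le
  -- Adding `1 - p` makes the compression `p w p` invertible in the whole algebra. Since `t`
  -- commutes with `p`, so does `t^(-1/2)`, and `t^(-1/2) p` is the required conjugator.
  have htu : IsUnit t := by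
    have e : t = 1 - -(p * (w - p) * star p) := by
      rw [hps, ht, mul_sub, sub_mul, hpp, hpp]; abel
    rw [e]
    refine isUnit_one_sub_of_norm_lt_one ?_
    rw [norm_neg]
    exact ((norm_conj_le _ _).trans
      (mul_le_of_le_one_left (norm_nonneg _) (pow_le_one₀ (norm_nonneg _) hpn))).trans_lt h
  have hts : IsStrictlyPositive t := htu.isStrictlyPositive htn
  have hconj := CFC.conjugate_rpow_neg_one_half t hts
  have hpt : p * t = p * w * p := by
    rw [ht, mul_add, mul_sub, mul_one, hpp, sub_self, add_zero]
    simp only [← mul_assoc, hpp]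
  have htp : t * p = p * w * p := by
    rw [ht, add_mul, sub_mul, one_mul, hpp, sub_self, add_zero, mul_assoc, hpp]
  have hcomm : Commute t p := by rw [Commute, SemiconjBy, htp, hpt]
  have hHp : Commute (t ^ (-(1 / 2) : ℝ)) p := by
    rw [CFC.rpow_def]
    exact hcomm.cfc_nnreal _
  have hH : IsSelfAdjoint (t ^ (-(1 / 2) : ℝ)) := IsSelfAdjoint.of_nonneg CFC.rpow_nonneg
  refine ⟨t ^ (-(1 / 2) : ℝ) * p, ?_⟩
  set H := t ^ (-(1 / 2) : ℝ)
  rw [star_mul, hps, hH.star_eq]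
  calc H * p * w * (p * H) = H * (p * w * p) * H := by noncomm_ring
    _ = H * t * (p * H) := by rw [← htp]; noncomm_ring
    _ = H * t * H * p := by rw [← hHp.eq]; noncomm_ring
    _ = p := by rw [hconj, one_mul]

end CStar
end CuntzW

namespace CuntzW

/-! ### Stable rank one passes to matrix algebras. -/

section Matrix

open Matrix

variable {A : Type*} [CStarAlgebra A]

/-- Block LDU factorisation: the outer factors are unipotent and the middle one is the diagonal of
`a` and its Schur complement. -/
theorem isUnit_fromBlocks_of_schur {R m n : Type*} [Ring R] [Fintype m] [Fintype n]
    [DecidableEq m] [DecidableEq n] (a : (Matrix m m R)ˣ) (b : Matrix m n R) (c : Matrix n m R)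
    (d : Matrix n n R) (h : IsUnit (d - c * (↑a⁻¹ : Matrix m m R) * b)) :
    IsUnit (fromBlocks (a : Matrix m m R) b c d) := by
  obtain ⟨s, hs⟩ := h
  have hL : IsUnit (fromBlocks 1 0 (c * (↑a⁻¹ : Matrix m m R)) 1 : Matrix (m ⊕ n) (m ⊕ n) R) :=
    isUnit_iff_exists.2 ⟨fromBlocks 1 0 (-(c * (↑a⁻¹ : Matrix m m R))) 1,
      by simp [fromBlocks_multiply], by simp [fromBlocks_multiply]⟩
  have hU : IsUnit (fromBlocks 1 ((↑a⁻¹ : Matrix m m R) * b) 0 1 : Matrix (m ⊕ n) (m ⊕ n) R) :=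
    isUnit_iff_exists.2 ⟨fromBlocks 1 (-((↑a⁻¹ : Matrix m m R) * b)) 0 1,
      by simp [fromBlocks_multiply], by simp [fromBlocks_multiply]⟩
  have hD : IsUnit (fromBlocks (a : Matrix m m R) 0 0 (s : Matrix n n R)) :=
    isUnit_iff_exists.2 ⟨fromBlocks (↑a⁻¹ : Matrix m m R) 0 0 (↑s⁻¹ : Matrix n n R),
      by simp [fromBlocks_multiply], by simp [fromBlocks_multiply]⟩
  have e : fromBlocks (a : Matrix m m R) b c d = fromBlocks 1 0 (c * (↑a⁻¹ : Matrix m m R)) 1 *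
      fromBlocks (a : Matrix m m R) 0 0 (s : Matrix n n R) *
      fromBlocks 1 ((↑a⁻¹ : Matrix m m R) * b) 0 1 := by
    simp [fromBlocks_multiply, hs, Matrix.mul_assoc, ← Matrix.mul_assoc (a : Matrix m m R)]
  rw [e]
  exact (hL.mul hD).mul hU

/-- Two perturbations: the upper left block is made invertible, then the lower right block is moved
until the Schur complement is invertible. -/
theorem dense_isUnit_sum {R m n : Type*} [Ring R] [TopologicalSpace R] [IsTopologicalRing R]
    [Fintype m] [Fintype n] [DecidableEq m] [DecidableEq n]
    (hm : Dense {M : Matrix m m R | IsUnit M}) (hn : Dense {M : Matrix n n R | IsUnit M}) :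
    Dense {M : Matrix (m ⊕ n) (m ⊕ n) R | IsUnit M} := by
  have h1 : ∀ (a : Matrix m m R) b c d, IsUnit a →
      fromBlocks a b c d ∈ closure {M : Matrix (m ⊕ n) (m ⊕ n) R | IsUnit M} := by
    rintro _ b c d ⟨a, rfl⟩
    have := map_mem_closure (f := fun s : Matrix n n R =>
      fromBlocks (a : Matrix m m R) b c (s + c * (↑a⁻¹ : Matrix m m R) * b))
      (t := {M : Matrix (m ⊕ n) (m ⊕ n) R | IsUnit M})
      (Continuous.matrix_fromBlocks continuous_const continuous_const continuous_const
        (continuous_id.add continuous_const))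
      (hn (d - c * (↑a⁻¹ : Matrix m m R) * b))
      fun s hs => isUnit_fromBlocks_of_schur a b c _ (by rwa [add_sub_cancel_right])
    simpa using this
  intro M
  rw [← fromBlocks_toBlocks M, ← closure_closure]
  exact map_mem_closure (f := fun a : Matrix m m R =>
      fromBlocks a M.toBlocks₁₂ M.toBlocks₂₁ M.toBlocks₂₂)
    (Continuous.matrix_fromBlocks continuous_id continuous_const continuous_const
      continuous_const) (hm M.toBlocks₁₁) fun a ha => h1 a _ _ _ ha

theorem dense_isUnit_of_ringEquiv {R S : Type*} [Ring R] [Ring S] [TopologicalSpace R]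
    [TopologicalSpace S] (e : R ≃+* S) (he : Continuous e) (h : Dense {x : R | IsUnit x}) :
    Dense {x : S | IsUnit x} := by
  refine (e.surjective.denseRange.dense_image he h).mono ?_
  rintro _ ⟨x, hx, rfl⟩
  exact IsUnit.map e hx

theorem dense_isUnit_matrix {R : Type*} [Ring R] [TopologicalSpace R] [IsTopologicalRing R]
    (hR : Dense {x : R | IsUnit x}) (n : ℕ) : Dense {M : Matrix (Fin n) (Fin n) R | IsUnit M} := by
  induction n with
  | zero => exact fun M => subset_closure (isUnit_of_subsingleton M)
  | succ n ih =>
    have h1 : Dense {M : Matrix (Fin 1) (Fin 1) R | IsUnit M} :=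
      dense_isUnit_of_ringEquiv (Matrix.uniqueRingEquiv (m := Fin 1) (A := R)).symm
        (by exact continuous_matrix fun i j => continuous_id) hR
    refine dense_isUnit_of_ringEquiv
      (Matrix.reindexRingEquiv R (finSumFinEquiv (m := n) (n := 1))) ?_ (dense_isUnit_sum ih h1)
    exact continuous_id.matrix_reindex _ _

/-- Matrix algebras over an algebra of stable rank one have stable rank one. -/
theorem HasStableRankOne.cstarMatrix (hA : HasStableRankOne A) (n : ℕ) :
    Dense {M : CStarMatrix (Fin n) (Fin n) A | IsUnit M} :=
  dense_isUnit_of_ringEquiv CStarMatrix.ofMatrixRingEquiv continuous_id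
    (dense_isUnit_matrix hA n)

end Matrix
end CuntzW

namespace CuntzW

/-! ### Transfer of the estimates to `M_∞(A)`. -/

section Limit

variable {A : Type*} [CStarAlgebra A]

namespace MInfty

theorem exists_of_ge (N : ℕ) (x : MInfty A) : ∃ K, N ≤ K ∧ ∃ a, x = of K a := by
  obtain ⟨n, a, rfl⟩ := exists_of x
  exact ⟨max N n, le_max_left _ _, _, (of_pad n _ (le_max_right N n) a).symm⟩

/-- The corner of `M_∞(A)` cut out by the unit of `M_N(A)` is `M_N(A)`. -/
theorem exists_of_eq_corner (N : ℕ) (x : MInfty A) :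
    ∃ a : CStarMatrix (Fin N) (Fin N) A, of N 1 * x * of N 1 = of N a := by
  obtain ⟨K, hK, b, rfl⟩ := exists_of_ge N x
  refine ⟨CStarMatrix.ofMatrix (Matrix.of fun i j => b (Fin.castLE hK i) (Fin.castLE hK j)), ?_⟩
  rw [← of_pad N K hK, ← of_pad N K hK (CStarMatrix.ofMatrix _), ← of_mul, ← of_mul]
  congr 1
  have h1 : ∀ i j : Fin K, pad A N K hK 1 i j = if i = j ∧ i.val < N then 1 else 0 := by
    intro i j
    rw [pad_apply]
    by_cases h : i.val < N ∧ j.val < N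
    · simp [h, CStarMatrix.one_apply, Fin.ext_iff]
    · rw [dif_neg h, if_neg]
      rintro ⟨rfl, h'⟩
      exact h ⟨h', h'⟩
  ext i j
  simp only [CStarMatrix.mul_apply, h1, pad_apply, ite_and, ite_mul, mul_ite, one_mul, mul_one,
    zero_mul, mul_zero, Finset.sum_ite_eq, Finset.sum_ite_eq', Finset.mem_univ, if_true]
  by_cases hi : i.val < N <;> by_cases hj : j.val < N <;> simp [hi, hj]

theorem of_one_mul_of (N : ℕ) (a : CStarMatrix (Fin N) (Fin N) A) : of N 1 * of N a = of N a := by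
  rw [← of_mul, one_mul]

theorem of_mul_of_one (N : ℕ) (a : CStarMatrix (Fin N) (Fin N) A) : of N a * of N 1 = of N a := by
  rw [← of_mul, mul_one]

theorem star_of_one (N : ℕ) : star (of N 1 : MInfty A) = of N 1 := by
  rw [← of_star, star_one]

theorem of_sub (n : ℕ) (a b : CStarMatrix (Fin n) (Fin n) A) :
    of n (a - b) = of n a - of n b := by
  rw [sub_eq_add_neg, of_add, of_neg, sub_eq_add_neg]

variable [PartialOrder A] [StarOrderedRing A]

theorem norm_le_one_of_star_mul_self {N : ℕ} {u : CStarMatrix (Fin N) (Fin N) A}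
    (hu : star u * u = 1) : ‖of N u‖ ≤ 1 := CuntzW.norm_le_one_of_star_mul_self hu

theorem norm_of_one_le (N : ℕ) : ‖(of N 1 : MInfty A)‖ ≤ 1 :=
  norm_le_one_of_star_mul_self (by simp)

theorem norm_self_mul_star (x : MInfty A) : ‖x * star x‖ = ‖x‖ ^ 2 := by
  obtain ⟨n, a, rfl⟩ := exists_of x
  rw [← of_star, ← of_mul, norm_of, norm_of, sq]
  exact CStarRing.norm_self_mul_star

theorem exists_contraction_conj (x : MInfty A) {ζ : ℝ} (hζ : 0 < ζ) :
    ∃ v : MInfty A, ‖v‖ ≤ 1 ∧ ‖v * (x * star x) * star v - star x * x‖ ≤ ζ := by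
  obtain ⟨n, a, rfl⟩ := exists_of x
  obtain ⟨v, hv, h⟩ := CuntzW.exists_contraction_conj a hζ
  refine ⟨of n v, hv, ?_⟩
  simpa only [← of_star, ← of_mul, ← of_sub, norm_of] using h

theorem exists_sqrt_star_mul_self_add (v w : MInfty A) {l : ℝ} (hl : 0 < l) :
    ∃ T S : MInfty A, S * (T * w) = w ∧
      ‖star (T * w) * (T * w) - star (v * w) * (v * w)‖ ≤ l * ‖w‖ ^ 2 ∧
      ‖T‖ ^ 2 ≤ ‖v‖ ^ 2 + l ∧ ‖S‖ ^ 2 ≤ l⁻¹ := by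
  obtain ⟨n, v, w, rfl, rfl⟩ := exists_of₂ v w
  obtain ⟨T, S, hST, hTT, hT, hS⟩ := CuntzW.exists_sqrt_star_mul_self_add_mul v w hl
  refine ⟨of n T, of n S, ?_, ?_, hT, hS⟩
  · rw [← of_mul, ← of_mul, hST]
  · simpa only [← of_star, ← of_mul, ← of_sub, norm_of] using hTT

theorem exists_conj_eq_of_norm_sub_lt_one {p w : MInfty A} (hp : IsStarProjection p)
    (hw : IsPositive w) (h : ‖w - p‖ < 1) : ∃ x : MInfty A, x * w * star x = p := by
  obtain ⟨y, rfl⟩ := hw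
  obtain ⟨n, p, y, rfl, rfl⟩ := exists_of₂ p y
  have hp' : IsStarProjection p := by
    refine ⟨of_injective n ?_, of_injective n ?_⟩
    · rw [of_mul]; exact hp.isIdempotentElem
    · rw [of_star]; exact hp.isSelfAdjoint
  obtain ⟨x, hx⟩ := CuntzW.exists_conj_eq_of_norm_sub_lt_one hp' (star_mul_self_nonneg y)
    (by simpa only [← of_star, ← of_mul, ← of_sub, norm_of] using h)
  exact ⟨of n x, by rw [← of_star, ← of_mul, ← of_star, ← of_mul, ← of_mul, hx]⟩

end MInfty

theorem IsPositive.conj {b : MInfty A} (hb : IsPositive b) (v : MInfty A) :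
    IsPositive (v * b * star v) := by
  obtain ⟨x, rfl⟩ := hb
  exact ⟨x * star v, by simp [mul_assoc]⟩

variable [PartialOrder A] [StarOrderedRing A]

/-- An element of `M_N(A)` is positive in `M_∞(A)` if and only if it is positive in `M_N(A)`. -/
theorem isPositive_of_iff (N : ℕ) (a : CStarMatrix (Fin N) (Fin N) A) :
    IsPositive (MInfty.of N a) ↔ 0 ≤ a := by
  constructor
  · rintro ⟨x, hx⟩
    -- The square root `x` may live in a larger matrix algebra than `a`.
    obtain ⟨K, hK, y, rfl⟩ := MInfty.exists_of_ge N x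
    rw [← MInfty.of_star, ← MInfty.of_mul, ← MInfty.of_pad N K hK] at hx
    have hpa : pad A N K hK a = star y * y := MInfty.of_injective K hx
    exact nonneg_of_map_nonneg _ (pad_injective A N K hK) (hpa ▸ star_mul_self_nonneg y)
  · intro h
    obtain ⟨x, rfl⟩ := nonneg_iff_exists_star_mul_self.1 h
    exact ⟨MInfty.of N x, by rw [← MInfty.of_star, ← MInfty.of_mul]⟩

end Limit
end CuntzW

namespace CuntzW

/-! ### The perturbation step, where stable rank one enters. -/

section Step

variable {A : Type*} [CStarAlgebra A] [PartialOrder A] [StarOrderedRing A]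

set_option maxHeartbeats 1000000 in
/-- Given `a ≾ p` with `p` in `M_N(A)`, `k ≾ a`, and `c` in `M_N(A)` that is up to `τ` of the form
`v a v*`, there is a positive `c₀` in `M_N(A)` close to `c` which is up to an arbitrary `τ'` of the
form `v a v*`, and from which `k` can be approximated up to `ε`, uniformly in a neighbourhood whose
radius does not depend on `τ'`. -/
theorem exists_positive_near (hA : HasStableRankOne A) {N : ℕ} {p a k : MInfty A}
    (hp : IsStarProjection p) (hpN : p * MInfty.of N 1 = p) (c : CStarMatrix (Fin N) (Fin N) A)
    (hap : ∀ ε > 0, ∃ w, ‖w * p * star w - a‖ < ε)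
    (hka : ∀ ε > 0, ∃ q, ‖q * a * star q - k‖ < ε) {τ : ℝ} (hτ : 0 < τ)
    (hca : ∃ v, ‖v * a * star v - MInfty.of N c‖ < τ) {ε : ℝ} (hε : 0 < ε) :
    ∃ δ > 0, ∀ τ' > 0, ∃ c₀ : CStarMatrix (Fin N) (Fin N) A, 0 ≤ c₀ ∧ ‖c₀ - c‖ < 4 * τ ∧
      (∃ v, ‖v * a * star v - MInfty.of N c₀‖ < τ') ∧
      ∀ c₁ : CStarMatrix (Fin N) (Fin N) A, ‖c₁ - c₀‖ ≤ δ →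
        ∃ v, ‖v * MInfty.of N c₁ * star v - k‖ < ε := by
  obtain ⟨e, he⟩ : ∃ e : MInfty A, e = MInfty.of N 1 := ⟨_, rfl⟩
  have hes : star e = e := he ▸ MInfty.star_of_one N
  have hee : e * e = e := by rw [he, MInfty.of_one_mul_of]
  have hen : ‖e‖ ≤ 1 := he ▸ MInfty.norm_of_one_le N
  have hcontr : ∀ u z : MInfty A, ‖u‖ ≤ 1 → ‖u * z * star u‖ ≤ ‖z‖ := fun u z hu =>
    (norm_conj_le u z).trans
      (mul_le_of_le_one_left (norm_nonneg _) (pow_le_one₀ (norm_nonneg _) hu))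
  rw [← he] at hpN
  -- Compressing `v` by the unit `e` of `M_N(A)` ensures that `v * W` below lies in `M_N(A)`.
  obtain ⟨v, hev, hv⟩ : ∃ v, e * v = v ∧ ‖v * a * star v - MInfty.of N c‖ < τ := by
    obtain ⟨v, hv⟩ := hca
    refine ⟨e * v, by rw [← mul_assoc, hee], ?_⟩
    have h1 : e * v * a * star (e * v) - MInfty.of N c
        = e * (v * a * star v - MInfty.of N c) * star e := by
      have : MInfty.of N c = e * MInfty.of N c * e := by
        rw [he, MInfty.of_one_mul_of, MInfty.of_mul_of_one]
      nth_rewrite 1 [this]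
      rw [star_mul, hes]
      noncomm_ring
    rw [h1]
    exact (hcontr _ _ hen).trans_lt hv
  obtain ⟨q, hq⟩ := hka (ε / 2) (half_pos hε)
  -- Gives `l ‖W‖² ≤ τ` for every `W` with `W W*` within one of `a`, so `l` is fixed before `W` and
  -- `τ'`.
  set l := τ / (‖a‖ + 1) with hl
  have hl0 : 0 < l := by positivity
  have haux : ∀ C η : ℝ, 0 ≤ C → 0 < η → C * (η / (C + 1)) ≤ η := fun C η hC hη => by
    rw [mul_div_assoc', div_le_iff₀ (by positivity)]
    nlinarith
  have hQ : 0 ≤ ‖q‖ ^ 2 * l⁻¹ := by positivity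
  -- From `‖S‖² ≤ l⁻¹`, conjugation by `q * S` enlarges an error `δ` to at most `ε / 8`. Only `q`
  -- and `l` enter, hence the independence from `τ'`.
  obtain ⟨δ, hδ⟩ : ∃ δ, δ = ε / 8 / (‖q‖ ^ 2 * l⁻¹ + 1) := ⟨_, rfl⟩
  have hδ0 : 0 < δ := by rw [hδ]; positivity
  have hQδ : ‖q‖ ^ 2 * l⁻¹ * δ ≤ ε / 8 := hδ ▸ haux _ _ hQ (by positivity)
  refine ⟨δ, hδ0, fun τ' hτ' => ?_⟩
  -- `σ` measures how well `W W*` approximates `a`; the bounds control this error after conjugation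
  -- by `v`, `T` and `q`.
  obtain ⟨σ, hσ0, hσ1, hσ2, hσ3, hσ4⟩ : ∃ σ > 0, σ ≤ 1 ∧ ‖v‖ ^ 2 * σ ≤ τ ∧
      (‖v‖ ^ 2 + l) * σ ≤ τ' / 4 ∧ ‖q‖ ^ 2 * σ ≤ ε / 8 := by
    refine ⟨min (min 1 (τ / (‖v‖ ^ 2 + 1)))
      (min (τ' / 4 / (‖v‖ ^ 2 + l + 1)) (ε / 8 / (‖q‖ ^ 2 + 1))), by positivity,
      (min_le_left _ _).trans (min_le_left _ _), ?_, ?_, ?_⟩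
    · refine le_trans ?_ (haux (‖v‖ ^ 2) τ (by positivity) hτ)
      gcongr
      exact (min_le_left _ _).trans (min_le_right _ _)
    · refine le_trans ?_ (haux (‖v‖ ^ 2 + l) (τ' / 4) (by positivity) (by positivity))
      gcongr
      exact (min_le_right _ _).trans (min_le_left _ _)
    · refine le_trans ?_ (haux (‖q‖ ^ 2) (ε / 8) (by positivity) (by positivity))
      gcongr
      exact (min_le_right _ _).trans (min_le_right _ _)
  obtain ⟨w, hw⟩ := hap σ hσ0
  obtain ⟨W, hWdef⟩ : ∃ W, W = w * p := ⟨_, rfl⟩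
  have hWW : W * star W = w * p * star w := by
    rw [hWdef, star_mul, hp.isSelfAdjoint.star_eq]
    calc w * p * (p * star w) = w * (p * p) * star w := by noncomm_ring
      _ = _ := by rw [hp.isIdempotentElem.eq]
  have hWe : W * e = W := by rw [hWdef, mul_assoc, hpN]
  rw [← hWW] at hw
  have hWn : l * ‖W‖ ^ 2 ≤ τ := by
    have h1 : ‖W‖ ^ 2 ≤ ‖a‖ + 1 := by
      rw [← MInfty.norm_self_mul_star]
      linarith [norm_le_norm_add_norm_sub' (W * star W) a]
    calc l * ‖W‖ ^ 2 ≤ l * (‖a‖ + 1) := by gcongr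
      _ = τ := div_mul_cancel₀ _ (by positivity)
  obtain ⟨T, S, hST, hTT, hT, hS⟩ := MInfty.exists_sqrt_star_mul_self_add v W hl0
  obtain ⟨X, hX⟩ : ∃ X, X = T * W := ⟨_, rfl⟩
  rw [← hX] at hST hTT
  have hXe : X * e = X := by rw [hX, mul_assoc, hWe]
  have heX : e * star X = star X := by rw [← hes, ← star_mul, hXe]
  obtain ⟨y, hy⟩ : ∃ y, v * W = MInfty.of N y := by
    obtain ⟨y, hy⟩ := MInfty.exists_of_eq_corner N (v * W)
    refine ⟨y, ?_⟩
    rw [← hy, ← he, ← mul_assoc, hev, mul_assoc, hWe]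
  obtain ⟨x, hx⟩ : ∃ x, star X * X = MInfty.of N x := by
    obtain ⟨x, hx⟩ := MInfty.exists_of_eq_corner N (star X * X)
    refine ⟨x, ?_⟩
    rw [← hx, ← he, ← mul_assoc, heX, mul_assoc, hXe]
  -- With `y = v W`, `u` takes `y* y`, which is close to `X* X`, near `y y* = v W W* v*`, and so
  -- near `c`.
  obtain ⟨u, huu, -, huy⟩ := exists_unitary_conj_near (hA.cstarMatrix N) y hτ
  have hun : ‖MInfty.of N u‖ ≤ 1 := MInfty.norm_le_one_of_star_mul_self huu
  have huu' : star (MInfty.of N u) * MInfty.of N u = e := by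
    rw [← MInfty.of_star, ← MInfty.of_mul, huu, he]
  have hof : MInfty.of N (u * x * star u) =
      MInfty.of N u * (star X * X) * star (MInfty.of N u) := by
    rw [MInfty.of_mul, MInfty.of_mul, MInfty.of_star, hx]
  set U := MInfty.of N u with hU
  have hTW : X * star X = T * (W * star W) * star T := by
    rw [hX, star_mul]; noncomm_ring
  have hSX : S * (X * star X) * star S = W * star W := by
    rw [← hST, star_mul]; noncomm_ring
  -- The witness is `U X* X U*`. It is tied to `a` through `X X* = T W W* T*`, and `S` undoes `T` to
  -- recover `W W*`.
  refine ⟨u * x * star u, ?_, ?_, ?_, ?_⟩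
  · rw [← isPositive_of_iff, hof]
    exact IsPositive.conj ⟨X, rfl⟩ U
  · rw [← MInfty.norm_of, MInfty.of_sub, hof]
    have h1 : ‖U * (star X * X - star (v * W) * (v * W)) * star U‖ ≤ τ :=
      (hcontr _ _ hun).trans (hTT.trans hWn)
    have h2 : ‖U * (star (v * W) * (v * W)) * star U - v * W * star (v * W)‖ < τ := by
      simpa only [hU, hy, ← MInfty.of_star, ← MInfty.of_mul, ← MInfty.of_sub, MInfty.norm_of]
        using huy
    have h3 : ‖v * (W * star W - a) * star v‖ ≤ τ :=
      (norm_conj_le _ _).trans (le_trans (by gcongr) hσ2)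
    -- Four errors of at most `τ` each, two of them strict.
    have e1 : U * (star X * X) * star U - MInfty.of N c
        = U * (star X * X - star (v * W) * (v * W)) * star U
          + (U * (star (v * W) * (v * W)) * star U - v * W * star (v * W))
          + v * (W * star W - a) * star v + (v * a * star v - MInfty.of N c) := by
      rw [star_mul]; noncomm_ring
    rw [e1]
    refine (norm_add_le _ _).trans_lt ?_
    refine (add_le_add_left (norm_add₃_le) _).trans_lt ?_
    linarith
  · obtain ⟨V, hV, hVX⟩ := MInfty.exists_contraction_conj X (show 0 < τ' / 4 by positivity)
    refine ⟨U * V * T, ?_⟩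
    have hUV : ‖U * V‖ ≤ 1 := (norm_mul_le _ _).trans (mul_le_one₀ hun (norm_nonneg _) hV)
    have e1 : U * V * T * a * star (U * V * T) - MInfty.of N (u * x * star u)
        = (U * V) * (T * (a - W * star W) * star T) * star (U * V)
          + U * (V * (X * star X) * star V - star X * X) * star U := by
      rw [hof, hTW]
      simp only [star_mul]
      noncomm_ring
    have h1 : ‖T * (a - W * star W) * star T‖ ≤ τ' / 4 := by
      refine (norm_conj_le _ _).trans (le_trans ?_ hσ3)
      rw [norm_sub_rev]
      gcongr
    rw [e1]
    refine (norm_add_le _ _).trans_lt ?_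
    linarith [hcontr (U * V) (T * (a - W * star W) * star T) hUV,
      hcontr U (V * (X * star X) * star V - star X * X) hun]
  · intro c₁ hc₁
    -- The passage is now from `X* X` back to `X X*`, at cost `δ`.
    obtain ⟨V, hV, hVX⟩ := MInfty.exists_contraction_conj (star X) hδ0
    rw [star_star] at hVX
    refine ⟨q * S * V * star U, ?_⟩
    have hqS : ‖q * S‖ ^ 2 ≤ ‖q‖ ^ 2 * l⁻¹ := by
      calc ‖q * S‖ ^ 2 ≤ (‖q‖ * ‖S‖) ^ 2 := by gcongr; exact norm_mul_le _ _
        _ = ‖q‖ ^ 2 * ‖S‖ ^ 2 := mul_pow _ _ _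
        _ ≤ _ := by gcongr
    have hVU : ‖V * star U‖ ≤ 1 :=
      (norm_mul_le _ _).trans (mul_le_one₀ hV (norm_nonneg _) (by rwa [norm_star]))
    have hUX : star U * (U * (star X * X) * star U) * U = star X * X := by
      calc star U * (U * (star X * X) * star U) * U
          = (star U * U * star X) * (X * (star U * U)) := by noncomm_ring
        _ = _ := by rw [huu', heX, hXe]
    have e1 : q * S * V * star U * MInfty.of N c₁ * star (q * S * V * star U) - k
        = (q * S) * ((V * star U) * (MInfty.of N (c₁ - u * x * star u)) * star (V * star U))
            * star (q * S)
          + (q * S) * (V * (star X * X) * star V - X * star X) * star (q * S)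
          + q * (W * star W - a) * star q + (q * a * star q - k) := by
      rw [MInfty.of_sub, hof, ← hSX]
      nth_rewrite 2 [← hUX]
      simp only [star_mul, star_star]
      noncomm_ring
    have hb : ∀ z : MInfty A, ‖z‖ ≤ δ → ‖q * S * z * star (q * S)‖ ≤ ε / 8 := fun z hz =>
      (norm_conj_le _ _).trans (le_trans (by gcongr) hQδ)
    have h1 := hb _ ((hcontr (V * star U) (MInfty.of N (c₁ - u * x * star u)) hVU).trans hc₁)
    have h2 := hb _ hVX
    have h3 : ‖q * (W * star W - a) * star q‖ ≤ ε / 8 :=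
      (norm_conj_le _ _).trans (le_trans (by gcongr) hσ4)
    rw [e1]
    refine (norm_add_le _ _).trans_lt ?_
    refine (add_le_add_left (norm_add₃_le) _).trans_lt ?_
    linarith

end Step
end CuntzW

namespace CuntzW

/-! ### Construction of the upper bound. -/

section Supremum

variable {A : Type*} [CStarAlgebra A] [PartialOrder A] [StarOrderedRing A]

set_option maxHeartbeats 1000000 in
/-- If `A` has stable rank one, then an increasing sequence below a projection `p` has an upper
bound `b` in `M_∞(A)_+` that dominates `p` only if some term of the sequence does. -/
theorem exists_upper_bound_of_cuntzLE (hA : HasStableRankOne A) {p : MInfty A}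
    (hp : IsStarProjection p) (a : ℕ → PosMInfty A) (ha : ∀ m n, m ≤ n → CuntzLE (a m) (a n))
    (hap : ∀ n, CuntzLE (a n) ⟨p, isPositive_of_isStarProjection hp⟩) :
    ∃ b : PosMInfty A, (∀ n, CuntzLE (a n) b) ∧
      (CuntzLE ⟨p, isPositive_of_isStarProjection hp⟩ b →
        ∃ n, CuntzLE ⟨p, isPositive_of_isStarProjection hp⟩ (a n)) := by
  obtain ⟨N, p₀, hpN⟩ := MInfty.exists_of p
  have hp1 : p * MInfty.of N 1 = p := by rw [hpN, MInfty.of_mul_of_one]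
  -- A state is a matrix with a radius. Unpairing lets stage `n` serve the term of index `n.unpair.1
  -- ≤ n`, so each term is served infinitely often, with errors tending to zero.
  let Inv : ℕ → CStarMatrix (Fin N) (Fin N) A × ℝ → Prop := fun n s =>
    0 ≤ s.1 ∧ 0 < s.2 ∧ (∃ v, ‖v * (a n).1 * star v - MInfty.of N s.1‖ < s.2 / 16) ∧
      ∀ c₁, ‖c₁ - s.1‖ ≤ s.2 →
        ∃ v, ‖v * MInfty.of N c₁ * star v - (a n.unpair.1).1‖ < 1 / ((n : ℝ) + 1)
  have step : ∀ (n : ℕ) (c : CStarMatrix (Fin N) (Fin N) A) (τ η : ℝ), 0 < τ → 0 < η →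
      (∃ v, ‖v * (a n).1 * star v - MInfty.of N c‖ < τ) →
      ∃ s, Inv n s ∧ ‖s.1 - c‖ < 4 * τ ∧ s.2 ≤ η := by
    intro n c τ η hτ hη hc
    obtain ⟨δ, hδ, h⟩ := exists_positive_near (a := (a n).1) (k := (a n.unpair.1).1) hA hp hp1 c
      ((cuntzLE_iff _ _).1 (hap n))
      ((cuntzLE_iff _ _).1 (ha _ _ (Nat.unpair_left_le n))) hτ hc
      (show (0 : ℝ) < 1 / ((n : ℝ) + 1) by positivity)
    -- The tolerance is a fraction of the new radius, which itself depends on `δ`; this is why `δ`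
    -- had to be chosen before `τ'`.
    obtain ⟨c₀, h0, hcc, hv, hk⟩ := h (min δ η / 16) (by positivity)
    exact ⟨(c₀, min δ η), ⟨h0, by positivity, hv, fun c₁ h₁ => hk c₁ (h₁.trans (min_le_left _ _))⟩,
      hcc, min_le_right _ _⟩
  obtain ⟨s₀, hs₀, -, hs₀'⟩ := step 0 0 1 1 one_pos one_pos ⟨0, by simp [MInfty.of_zero]⟩
  have next : ∀ (n : ℕ) (s : {s // Inv n s}), ∃ t : {t // Inv (n + 1) t},
      ‖t.1.1 - s.1.1‖ ≤ s.1.2 / 4 ∧ t.1.2 ≤ s.1.2 / 2 := by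
    rintro n ⟨s, h0, hpos, ⟨v, hv⟩, -⟩
    have hv' : ∃ w, ‖w * (a (n + 1)).1 * star w - MInfty.of N s.1‖ < s.2 / 16 := by
      obtain ⟨η, hη, hvη⟩ : ∃ η > 0, ‖v * (a n).1 * star v - MInfty.of N s.1‖ + η ≤ s.2 / 16 :=
        ⟨_, sub_pos.2 hv, by linarith⟩
      obtain ⟨w, hw⟩ := (cuntzLE_iff _ _).1 (ha n (n + 1) n.le_succ) (η / (‖v‖ ^ 2 + 1))
        (by positivity)
      refine ⟨v * w, lt_of_lt_of_le ?_ hvη⟩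
      have e : v * w * (a (n + 1)).1 * star (v * w) - MInfty.of N s.1
          = (v * (a n).1 * star v - MInfty.of N s.1)
            + v * (w * (a (n + 1)).1 * star w - (a n).1) * star v := by
        rw [star_mul]; noncomm_ring
      rw [e]
      refine (norm_add_le _ _).trans_lt (add_lt_add_right ?_ _)
      refine (norm_conj_le _ _).trans_lt ?_
      rw [lt_div_iff₀ (by positivity), mul_comm] at hw
      refine lt_of_le_of_lt ?_ hw
      gcongr
      exact le_add_of_nonneg_right zero_le_one
    -- With tolerance `s.2 / 16` the matrix moves less than `s.2 / 4`, while the radius at least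
    -- halves.
    obtain ⟨t, ht, htc, hte⟩ := step (n + 1) s.1 (s.2 / 16) (s.2 / 2) (by positivity)
      (by positivity) hv'
    exact ⟨⟨t, ht⟩, by linarith, hte⟩
  choose g hg using next
  let f : ∀ n, {s // Inv n s} := fun n => Nat.rec ⟨s₀, hs₀⟩ g n
  obtain ⟨c, hc⟩ : ∃ c : ℕ → CStarMatrix (Fin N) (Fin N) A, ∀ n, c n = (f n).1.1 :=
    ⟨_, fun _ => rfl⟩
  obtain ⟨ρ, hρ⟩ : ∃ ρ : ℕ → ℝ, ∀ n, ρ n = (f n).1.2 := ⟨_, fun _ => rfl⟩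
  have hf : ∀ n, Inv n (c n, ρ n) := fun n => by rw [hc, hρ]; exact (f n).2
  have hcs : ∀ n, ‖c (n + 1) - c n‖ ≤ ρ n / 4 := fun n => by
    rw [hc, hc, hρ]; exact (hg n (f n)).1
  have hρs : ∀ n, ρ (n + 1) ≤ ρ n / 2 := fun n => by
    rw [hρ, hρ]; exact (hg n (f n)).2
  have hρ0 : ρ 0 ≤ 1 := by rw [hρ]; exact hs₀'
  clear_value f
  have hρpow : ∀ n, ρ n ≤ (1 / 2) ^ n := by
    intro n
    induction n with
    | zero => simpa using hρ0
    | succ n ih => rw [pow_succ]; linarith [hρs n]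
  have hcauchy : CauchySeq c := by
    refine cauchySeq_of_le_geometric (1 / 2) 1 (by norm_num) fun n => ?_
    rw [dist_eq_norm, norm_sub_rev]
    linarith [hcs n, hρpow n, (hf n).2.1]
  obtain ⟨b, hb⟩ := cauchySeq_tendsto_of_complete hcauchy
  have hdist : ∀ n, ‖b - c n‖ ≤ ρ n := by
    intro n
    -- Telescoping: each move satisfies `ρ m / 4 ≤ ρ m - ρ (m + 1)`, so the limit stays in every
    -- ball.
    have h1 : ∀ m, n ≤ m → ‖c m - c n‖ ≤ ρ n - ρ m := by
      intro m hm
      induction m, hm using Nat.le_induction with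
      | base => simp
      | succ m _ ih =>
        have hm0 : 0 < ρ m := (hf m).2.1
        linarith [norm_sub_le_norm_sub_add_norm_sub (c (m + 1)) (c m) (c n), hcs m, hρs m]
    refine le_of_tendsto (hb.sub_const (c n)).norm ?_
    filter_upwards [eventually_ge_atTop n] with m hm
    have hm0 : 0 < ρ m := (hf m).2.1
    linarith [h1 m hm]
  have hb0 : 0 ≤ b := ge_of_tendsto' hb fun n => (hf n).1
  refine ⟨⟨MInfty.of N b, (isPositive_of_iff N b).2 hb0⟩, fun k => ?_, fun hle => ?_⟩
  · rw [cuntzLE_iff]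
    intro ε hε
    obtain ⟨m, hm⟩ := exists_nat_one_div_lt hε
    -- Stage `Nat.pair k m` serves the term `a k` with error at most `1 / (m + 1)`.
    obtain ⟨v, hv⟩ := (hf (Nat.pair k m)).2.2.2 b (hdist _)
    refine ⟨v, ?_⟩
    rw [Nat.unpair_pair] at hv
    refine hv.trans_le (le_trans ?_ hm.le)
    gcongr
    exact Nat.right_le_pair k m
  · obtain ⟨v, hv⟩ := (cuntzLE_iff _ _).1 hle (1 / 2) (by norm_num)
    obtain ⟨n, hn⟩ := exists_pow_lt_of_lt_one
      (show (0 : ℝ) < 1 / 4 / (‖v‖ ^ 2 + 1) by positivity) (show (1 / 2 : ℝ) < 1 by norm_num)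
    have hn' : ‖v‖ ^ 2 * ρ n ≤ 1 / 4 := by
      rw [lt_div_iff₀ (by positivity), mul_comm] at hn
      refine le_trans ?_ hn.le
      gcongr
      · exact (hf n).2.1.le
      · exact le_add_of_nonneg_right zero_le_one
      · exact hρpow n
    obtain ⟨w, hw⟩ := (hf n).2.2.1
    have hρn : 0 < ρ n := (hf n).2.1
    have e : v * w * (a n).1 * star (v * w) - p
        = v * (w * (a n).1 * star w - MInfty.of N (c n)) * star v
          + v * MInfty.of N (c n - b) * star v + (v * MInfty.of N b * star v - p) := by
      rw [MInfty.of_sub, star_mul]; noncomm_ring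
    have h1 : ‖v * (w * (a n).1 * star w - MInfty.of N (c n)) * star v‖ ≤ 1 / 4 / 16 := by
      refine (norm_conj_le _ _).trans ?_
      calc ‖v‖ ^ 2 * _ ≤ ‖v‖ ^ 2 * (ρ n / 16) := by gcongr
        _ ≤ _ := by linarith
    have h2 : ‖v * MInfty.of N (c n - b) * star v‖ ≤ 1 / 4 := by
      refine (norm_conj_le _ _).trans (le_trans ?_ hn')
      rw [MInfty.norm_of, norm_sub_rev]
      gcongr
      exact hdist n
    -- The errors add up to less than `1/64 + 1/4 + 1/2 < 1`, after which closeness becomes an exact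
    -- equality.
    have h3 : ‖v * w * (a n).1 * star (v * w) - p‖ < 1 := by
      rw [e]
      refine norm_add₃_le.trans_lt ?_
      linarith [show ‖v * MInfty.of N b * star v - p‖ < 1 / 2 from hv]
    obtain ⟨x, hx⟩ := MInfty.exists_conj_eq_of_norm_sub_lt_one hp ((a n).2.conj (v * w)) h3
    refine ⟨n, (cuntzLE_iff _ _).2 fun ε hε => ⟨x * (v * w), ?_⟩⟩
    have e2 : x * (v * w) * (a n).1 * star (x * (v * w)) - p = 0 := by
      rw [sub_eq_zero, ← hx, star_mul x]; noncomm_ring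
    rw [e2, norm_zero]
    exact hε

end Supremum
end CuntzW

theorem mainTheorem11 {A : Type*} [CStarAlgebra A] [PartialOrder A] [StarOrderedRing A]
    [TopologicalSpace.SeparableSpace A] (hsr : CuntzW.HasStableRankOne A)
    (x : ℕ → CuntzW.CuntzSemigroup A) (hbdd : BddAbove (Set.range x)) (hmono : Monotone x)
    (s : CuntzW.CuntzSemigroup A) (hsup : IsLUB (Set.range x) s)
    (p : CuntzW.MInfty A) (hp : IsStarProjection p) :
    s = CuntzW.projClass p hp ↔ ∃ n₀ : ℕ, ∀ n ≥ n₀, x n = CuntzW.projClass p hp := by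
  constructor
  · rintro rfl
    choose a hax using fun n => Quotient.exists_rep (x n)
    replace hax : ∀ n, CuntzW.cuntzClass (a n) = x n := hax
    have hle : ∀ n, x n ≤ CuntzW.projClass p hp := fun n => hsup.1 ⟨n, rfl⟩
    obtain ⟨b, hab, hpb⟩ := CuntzW.exists_upper_bound_of_cuntzLE hsr hp a
      (fun m n hmn => by
        rw [← CuntzW.cuntzClass_le_iff, hax, hax]
        exact hmono hmn)
      (fun n => by
        rw [← CuntzW.cuntzClass_le_iff, hax]
        exact hle n)
    -- Leastness of the supremum gives `⟨p⟩ ≤ ⟨b⟩`.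
    obtain ⟨n₀, hn₀⟩ := hpb ((CuntzW.cuntzClass_le_iff _ _).1 (hsup.2 (by
      rintro _ ⟨n, rfl⟩
      rw [← hax, CuntzW.cuntzClass_le_iff]
      exact hab n)))
    refine ⟨n₀, fun n hn => le_antisymm (hle n) (le_trans ?_ (hmono hn))⟩
    rw [← hax]
    exact (CuntzW.cuntzClass_le_iff _ _).2 hn₀
  · rintro ⟨n₀, h⟩
    refine le_antisymm (hsup.2 ?_) ?_
    · rintro _ ⟨n, rfl⟩
      rw [← h (max n n₀) (le_max_right _ _)]
      exact hmono (le_max_left _ _)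
    · rw [← h n₀ le_rfl]
      exact hsup.1 ⟨n₀, rfl⟩
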